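/- Let $m_1,m_2>0$, $\alpha_1,\alpha_2>1$, $\overline\gamma_1,\overline\gamma_2>0$, $\Omega>0$. Let $N_{1},N_{2},I_{1},I_{2}$ be real random variables on a probability space such that, for $j=1,2$, the squared Nakagami-$m$ multipath coefficient $N_j^2$ has the density $$f_{N_j^2}(x)=\frac{m_j^{m_j}x^{m_j-1}}{\Omega^{m_j}\Gamma(m_j)}\exp\left(-\frac{m_jx}{\Omega}\right),\qquad x>0,$$ and the shadowing coefficient $I_j$ has the inverse-gamma density $$f_{I_j}(y)=\frac{\overline\gamma_j^{\alpha_j}}{\Gamma(\alpha_j)\,y^{\alpha_j+1}}\exp\left(-\frac{\overline\gamma_j}{y}\right),\qquad y>0.$$ Assume that $N_j$ and $I_j$ are independent for each $j=1,2$, and that $N_1^2I_1$ and $N_2^2I_2$ are independent. Put $$\gamma=N_1^2I_1N_2^2I_2,\qquad \overline\gamma=\Omega^2\,\overline\gamma_1\overline\gamma_2,\qquad \tilde\gamma=\frac{m_1m_2}{\overline\gamma},\qquad \mathcal S_1=\frac1{\Gamma(m_1)\Gamma(m_2)\Gamma(\alpha_1)\Gamma(\alpha_2)}$$ (so $\overline\gamma=\overline\gamma_1\overline\gamma_2$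 when the mean square value $\Omega$ is normalized to $1$). Then the law of $\gamma$ is absolutely continuous and has a density $f_\gamma$ that vanishes on $(-\infty,0]$ and satisfies, for every $x>0$, $$\begin{aligned}f_\gamma(x)&=\mathcal S_1\,x^{-1}\,G^{2,2}_{2,2}\left(\frac{m_1m_2x}{\overline\gamma}\,\middle|\,\begin{matrix}1-\alpha_2,\,1-\alpha_1\\ m_1,\,m_2\end{matrix}\right)\\ &=\Gamma(m_1+\alpha_2)\Gamma(m_2+\alpha_2)\Gamma(m_1+\alpha_1)\Gamma(m_2+\alpha_1)\,\mathcal S_1\;{}_2\tilde F_1\left(m_1+\alpha_2,\,m_2+\alpha_2;\,\alpha_1+\alpha_2+m_1+m_2;\,1-\frac1{\tilde\gamma x}\right)x^{-\alpha_2-1}\,\tilde\gamma^{-\alpha_2}.\end{aligned}$$ Here $G^{2,2}_{2,2}\left(z\,\middle|\,\begin{smallmatrix}a_1,a_2\\ b_1,b_2\end{smallmatrix}\right)=\frac1{2\pi i}\int_{\sigma-i\infty}^{\sigma+i\infty}\Gamma(b_1-s)\Gamma(b_2-s)\Gamma(1-a_1+s)\Gamma(1-a_2+s)\,z^s\,ds$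 is Meijer's $G$-function, with a vertical contour separating the poles of $\Gamma(b_1-s)\Gamma(b_2-s)$ from those of $\Gamma(1-a_1+s)\Gamma(1-a_2+s)$, and ${}_2\tilde F_1$ is the regularized Gauss hypergeometric function, that is, the analytic continuation to $\mathbb C\setminus[1,\infty)$ of $\sum_{n\ge0}\frac{(a)_n(b)_n}{\Gamma(c+n)\,n!}z^n$, $|z|<1$. Moreover $\gamma$ is integrable and $$\mathbb E[\gamma]=\frac{\overline\gamma}{(\alpha_1-1)(\alpha_2-1)}.$$ -/

import Mathlib

open MeasureTheory ProbabilityTheory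

/-- Density of the inverse-gamma distribution with shape `α` and scale `β`. -/
noncomputable def invGammaPDFReal (α β y : ℝ) : ℝ :=
  if 0 < y then β ^ α / (Real.Gamma α * y ^ (α + 1)) * Real.exp (-(β / y)) else 0

/-- The inverse-gamma distribution with shape `α` and scale `β`. -/
noncomputable def invGammaMeasure (α β : ℝ) : Measure ℝ :=
  volume.withDensity fun y => ENNReal.ofReal (invGammaPDFReal α β y)

/-- The Mellin–Barnes kernel of Meijer's function `G^{m,n}_{p,q}` with upper parameters
`a` and lower parameters `b`:
`∏_{j ≤ m} Γ(b_j - s) ∏_{k ≤ n} Γ(1 - a_k + s) /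
  (∏_{j > m} Γ(1 - b_j + s) ∏_{k > n} Γ(a_k - s))`. -/
noncomputable def meijerKernel (m n : ℕ) {p q : ℕ} (a : Fin p → ℂ) (b : Fin q → ℂ) (s : ℂ) : ℂ :=
  (∏ j : Fin q, if (j : ℕ) < m then Complex.Gamma (b j - s) else (Complex.Gamma (1 - b j + s))⁻¹) *
  ∏ k : Fin p, if (k : ℕ) < n then Complex.Gamma (1 - a k + s) else (Complex.Gamma (a k - s))⁻¹

/-- The vertical line `Re s = σ` separates the poles `b_j + ℓ` of `Γ(b_j - s)`, `j ≤ m`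
(which lie to its right), from the poles `a_k - 1 - ℓ` of `Γ(1 - a_k + s)`, `k ≤ n`
(which lie to its left). -/
def MeijerSeparates (m n : ℕ) {p q : ℕ} (a : Fin p → ℂ) (b : Fin q → ℂ) (σ : ℝ) : Prop :=
  (∀ j : Fin q, (j : ℕ) < m → σ < (b j).re) ∧ (∀ k : Fin p, (k : ℕ) < n → (a k).re - 1 < σ)

open Classical in
/-- Meijer's function `G^{m,n}_{p,q}(z | a; b) = (1 / 2πi) ∫_L K(s) z^s ds`, where `K` is the
Mellin–Barnes kernel and the contour `L` runs from `σ - i∞` to `σ + i∞` along a vertical line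
that separates the two families of poles. Whenever the integral converges absolutely with
exponential decay, it does not depend on the separating line. -/
noncomputable def meijerG (m n : ℕ) {p q : ℕ} (a : Fin p → ℂ) (b : Fin q → ℂ) (z : ℂ) : ℂ :=
  if h : ∃ σ : ℝ, MeijerSeparates m n a b σ then
    (1 / (2 * (Real.pi : ℂ))) * ∫ t : ℝ,
      meijerKernel m n a b ((h.choose : ℂ) + t * Complex.I) *
        z ^ ((h.choose : ℂ) + t * Complex.I)
  else 0

/-- `F` is the principal branch, on `ℂ ∖ [1, ∞)`, of the regularized Gauss hypergeometric function:
it is holomorphic there and given on the unit disc by the series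
`∑ₙ (a)ₙ (b)ₙ / (Γ(c + n) n!) zⁿ`. -/
def IsRegGaussHG (a b c : ℂ) (F : ℂ → ℂ) : Prop :=
  DifferentiableOn ℂ F {z | 1 - z ∈ Complex.slitPlane} ∧
    ∀ z : ℂ, ‖z‖ < 1 → F z = Complex.regularizedGaussHGFun a b c z

open Classical in
/-- The regularized Gauss hypergeometric function on `ℂ ∖ [1, ∞)`: the analytic continuation of
the hypergeometric series. -/
noncomputable def regGaussHG (a b c z : ℂ) : ℂ :=
  if h : ∃ F : ℂ → ℂ, IsRegGaussHG a b c F then h.choose z else 0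

/-- The analytic continuation is unique. -/
theorem IsRegGaussHG.eqOn {a b c : ℂ} {F G : ℂ → ℂ} (hF : IsRegGaussHG a b c F)
    (hG : IsRegGaussHG a b c G) : Set.EqOn F G {z | 1 - z ∈ Complex.slitPlane} := by
  have ho : IsOpen {z : ℂ | 1 - z ∈ Complex.slitPlane} :=
    Complex.isOpen_slitPlane.preimage (by fun_prop)
  have hc : IsPreconnected {z : ℂ | 1 - z ∈ Complex.slitPlane} := by
    have h := (StarConvex.isPathConnected Complex.starConvex_one_slitPlane
      (Complex.one_mem_slitPlane)).isConnected
    have h2 := h.isPreconnected.image (fun z : ℂ => 1 - z) (by fun_prop)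
    convert h2 using 1
    ext z
    constructor
    · intro hz
      exact ⟨1 - z, hz, by ring⟩
    · rintro ⟨w, hw, rfl⟩
      simpa using hw
  refine (hF.1.analyticOnNhd ho).eqOn_of_preconnected_of_eventuallyEq (hG.1.analyticOnNhd ho) hc
    (z₀ := 0) (by simp) ?_
  filter_upwards [Metric.ball_mem_nhds (0 : ℂ) one_pos] with z hz
  have hz' : ‖z‖ < 1 := by simpa using hz
  rw [hF.2 z hz', hG.2 z hz']

theorem IsRegGaussHG.regGaussHG_eq {a b c : ℂ} {F : ℂ → ℂ} (hF : IsRegGaussHG a b c F) {z : ℂ}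
    (hz : 1 - z ∈ Complex.slitPlane) : regGaussHG a b c z = F z := by
  have h : ∃ F : ℂ → ℂ, IsRegGaussHG a b c F := ⟨F, hF⟩
  rw [regGaussHG, dif_pos h]
  exact h.choose_spec.eqOn hF hz

/-!
The product of a gamma and an independent inverse-gamma variable is a beta prime variable, so `γ` is
a product of two independent beta prime variables and its density is their multiplicative
convolution `∫₀^∞ f₁(u) f₂(x/u) du/u`. The substitution `u = t / (κ₁ (1 - t))` turns this
convolution into Euler's integral for the hypergeometric function at `1 - 1 / (κ₁ κ₂ x)`, where
`κ₁` and `κ₂` are the rates of the two beta prime variables. The Mellin transform of the density of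
`γ` is, up to a power and a constant, a product of four Gamma functions, because the Mellin
transform is multiplicative under the convolution. Mellin inversion then gives the Meijer
`G`-function, and the value of the transform at `2` is the mean.
-/

section EulerIntegral

open Set

/-- Euler's integral `∫₀¹ t^(b-1) (1-t)^(d-1) (1-zt)^(-a) dt`, which for `Re b, Re d > 0`
continues `Γ(b) Γ(d)` times the regularized Gauss series with parameters `a, b; b + d` to the whole
of `ℂ ∖ [1, ∞)`. -/
noncomputable def eulerIntegral (a b d z : ℂ) : ℂ :=
  ∫ t : ℝ in (0 : ℝ)..1, (t : ℂ) ^ (b - 1) * (1 - (t : ℂ)) ^ (d - 1) * (1 - z * t) ^ (-a)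

theorem isOpen_one_sub_mem_slitPlane : IsOpen {z : ℂ | 1 - z ∈ Complex.slitPlane} :=
  Complex.isOpen_slitPlane.preimage (by fun_prop)

theorem one_sub_mul_mem_slitPlane {z : ℂ} (hz : 1 - z ∈ Complex.slitPlane) {t : ℝ}
    (ht : t ∈ Icc (0 : ℝ) 1) : 1 - z * t ∈ Complex.slitPlane := by
  have h := Complex.starConvex_one_slitPlane hz (sub_nonneg.2 ht.2) ht.1 (by ring)
  convert h using 1
  simp only [Complex.real_smul, Complex.ofReal_sub, Complex.ofReal_one]
  ring

theorem continuousOn_one_sub_mul_cpow {z : ℂ} (hz : 1 - z ∈ Complex.slitPlane) (p : ℂ) :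
    ContinuousOn (fun t : ℝ => (1 - z * t) ^ p) (uIcc 0 1) := by
  rw [uIcc_of_le zero_le_one]
  exact ContinuousOn.cpow_const (by fun_prop) fun _ ht => one_sub_mul_mem_slitPlane hz ht

theorem hasDerivAt_one_sub_mul_cpow {z : ℂ} (hz : 1 - z ∈ Complex.slitPlane) {t : ℝ}
    (ht : t ∈ Icc (0 : ℝ) 1) (p : ℂ) :
    HasDerivAt (fun z : ℂ => (1 - z * t) ^ p) (p * (1 - z * t) ^ (p - 1) * (-(t : ℂ))) z := by
  have hlin : HasDerivAt (fun z : ℂ => 1 - z * t) (-(t : ℂ)) z := by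
    simpa using ((hasDerivAt_id z).mul_const (t : ℂ)).const_sub 1
  exact hlin.cpow_const (one_sub_mul_mem_slitPlane hz ht)

theorem exists_norm_deriv_one_sub_mul_cpow_le {K : Set ℂ} (hK : IsCompact K)
    (hK' : ∀ z ∈ K, 1 - z ∈ Complex.slitPlane) (p : ℂ) :
    ∃ C, ∀ z ∈ K, ∀ t ∈ Icc (0 : ℝ) 1, ‖p * (1 - z * t) ^ (p - 1) * (-(t : ℂ))‖ ≤ C := by
  have hcont : ContinuousOn (fun q : ℂ × ℝ => p * (1 - q.1 * q.2) ^ (p - 1) * (-(q.2 : ℂ)))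
      (K ×ˢ Icc (0 : ℝ) 1) :=
    (continuousOn_const.mul (ContinuousOn.cpow_const (by fun_prop) fun q hq =>
      one_sub_mul_mem_slitPlane (hK' q.1 hq.1) hq.2)).mul (by fun_prop)
  obtain ⟨C, hC⟩ := (hK.prod isCompact_Icc).exists_bound_of_continuousOn hcont
  exact ⟨C, fun z hz t ht => hC (z, t) ⟨hz, ht⟩⟩

variable {w : ℝ → ℂ}

theorem intervalIntegrable_mul_one_sub_mul_cpow (hw : IntervalIntegrable w volume 0 1) {z : ℂ}
    (hz : 1 - z ∈ Complex.slitPlane) (p : ℂ) :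
    IntervalIntegrable (fun t : ℝ => w t * (1 - z * t) ^ p) volume 0 1 :=
  hw.mul_continuousOn (continuousOn_one_sub_mul_cpow hz p)

theorem differentiableOn_integral_mul_one_sub_mul_cpow (hw : IntervalIntegrable w volume 0 1)
    (p : ℂ) :
    DifferentiableOn ℂ (fun z => ∫ t : ℝ in (0 : ℝ)..1, w t * (1 - z * t) ^ p)
      {z | 1 - z ∈ Complex.slitPlane} := by
  intro z₀ hz₀
  have hnhds := isOpen_one_sub_mem_slitPlane.mem_nhds hz₀
  obtain ⟨r, hr, hball⟩ := Metric.nhds_basis_closedBall.mem_iff.1 hnhds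
  obtain ⟨C, hC⟩ := exists_norm_deriv_one_sub_mul_cpow_le (isCompact_closedBall z₀ r)
    (fun z hz => hball hz) p
  have hIcc {t : ℝ} (ht : t ∈ uIoc (0 : ℝ) 1) : t ∈ Icc (0 : ℝ) 1 :=
    Ioc_subset_Icc_self (by rwa [uIoc_of_le zero_le_one] at ht)
  have hderiv_meas : IntervalIntegrable
      (fun t : ℝ => w t * (p * (1 - z₀ * t) ^ (p - 1) * (-(t : ℂ)))) volume 0 1 :=
    hw.mul_continuousOn
      ((continuousOn_const.mul (continuousOn_one_sub_mul_cpow hz₀ _)).mul (by fun_prop))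
  have hderiv := intervalIntegral.hasDerivAt_integral_of_dominated_loc_of_deriv_le
    (F := fun z (t : ℝ) => w t * (1 - z * t) ^ p)
    (F' := fun z (t : ℝ) => w t * (p * (1 - z * t) ^ (p - 1) * (-(t : ℂ))))
    (bound := fun t => ‖w t‖ * C) (Metric.closedBall_mem_nhds z₀ hr)
    (Filter.eventually_of_mem hnhds fun z hz =>
      (intervalIntegrable_mul_one_sub_mul_cpow hw hz p).def'.aestronglyMeasurable)
    (intervalIntegrable_mul_one_sub_mul_cpow hw hz₀ p) hderiv_meas.def'.aestronglyMeasurable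
    (ae_of_all _ fun t ht z hz => by
      rw [norm_mul]
      exact mul_le_mul_of_nonneg_left (hC z hz t (hIcc ht)) (norm_nonneg _))
    (hw.norm.mul_const C)
    (ae_of_all _ fun t ht z hz => (hasDerivAt_one_sub_mul_cpow (hball hz) (hIcc ht) p).const_mul _)
  exact hderiv.2.differentiableAt.differentiableWithinAt

theorem ringChoose_add_sub_one (a : ℂ) (n : ℕ) :
    Ring.choose (a + n - 1) n = (ascPochhammer ℂ n).eval a / (n.factorial : ℂ) := by
  rw [eq_div_iff (by exact_mod_cast n.factorial_ne_zero), mul_comm, ← nsmul_eq_mul,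
    ← Ring.descPochhammer_eq_factorial_smul_choose,
    Polynomial.descPochhammer_smeval_eq_ascPochhammer, Polynomial.ascPochhammer_smeval_cast,
    Polynomial.ascPochhammer_smeval_eq_eval]
  congr 1
  ring

theorem hasSum_one_sub_cpow_neg (a : ℂ) {z : ℂ} (hz : ‖z‖ < 1) :
    HasSum (fun n : ℕ => (ascPochhammer ℂ n).eval a / (n.factorial : ℂ) * z ^ n)
      ((1 - z) ^ (-a)) := by
  have h := (Complex.one_div_one_sub_cpow_hasFPowerSeriesOnBall_zero a).hasSum (y := z)
    (by simpa [enorm_eq_nnnorm, ← NNReal.coe_lt_one] using hz)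
  simpa [ringChoose_add_sub_one, Complex.cpow_neg, mul_comm] using h

theorem hasSum_integral_mul_one_sub_mul_cpow_neg (hw : IntervalIntegrable w volume 0 1)
    (a : ℂ) {z : ℂ} (hz : ‖z‖ < 1) :
    HasSum (fun n : ℕ => (ascPochhammer ℂ n).eval a / (n.factorial : ℂ) * z ^ n *
        ∫ t : ℝ in (0 : ℝ)..1, w t * (t : ℂ) ^ n)
      (∫ t : ℝ in (0 : ℝ)..1, w t * (1 - z * t) ^ (-a)) := by
  set A : ℕ → ℂ := fun n => (ascPochhammer ℂ n).eval a / (n.factorial : ℂ) * z ^ n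
  have hA : Summable fun n => ‖A n‖ := (hasSum_one_sub_cpow_neg a hz).summable.norm
  simp_rw [← intervalIntegral.integral_const_mul]
  refine intervalIntegral.hasSum_integral_of_dominated_convergence (fun n t => ‖A n‖ * ‖w t‖)
    (fun n => ((hw.mul_continuousOn (by fun_prop)).const_mul (A n)).def'.aestronglyMeasurable)
    (fun n => ae_of_all _ fun t ht => ?_) (ae_of_all _ fun t _ => hA.mul_right _) ?_
    (ae_of_all _ fun t ht => ?_)
  · rw [uIoc_of_le zero_le_one] at ht
    rw [norm_mul (A n), norm_mul (w t), norm_pow, Complex.norm_of_nonneg ht.1.le]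
    gcongr
    exact mul_le_of_le_one_right (norm_nonneg _) (pow_le_one₀ ht.1.le ht.2)
  · simp_rw [tsum_mul_right]
    exact hw.norm.const_mul _
  · rw [uIoc_of_le zero_le_one] at ht
    have hzt : ‖z * t‖ < 1 := by
      rw [norm_mul, Complex.norm_of_nonneg ht.1.le]
      exact (mul_le_of_le_one_right (norm_nonneg z) ht.2).trans_lt hz
    refine ((hasSum_one_sub_cpow_neg a hzt).mul_left (w t)).congr_fun fun n => ?_
    simp only [mul_pow]
    ring

theorem betaIntegral_add_nat {b d : ℂ} (hb : 0 < b.re) (hd : 0 < d.re) (n : ℕ) :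
    Complex.betaIntegral (b + n) d = Complex.Gamma b * Complex.Gamma d *
      ((ascPochhammer ℂ n).eval b / Complex.Gamma (b + d + n)) := by
  have hb_ne : ∀ k : ℕ, b ≠ -k := by
    rintro k rfl
    simp only [Complex.neg_re, Complex.natCast_re, Left.neg_pos_iff] at hb
    exact hb.not_ge k.cast_nonneg
  have hbn : 0 < (b + n).re := by
    simpa only [Complex.add_re, Complex.natCast_re] using add_pos_of_pos_of_nonneg hb n.cast_nonneg
  have hΓ := Complex.Gamma_add_nat_div_Gamma_eq (n := n) b hb_ne
  rw [div_eq_iff (Complex.Gamma_ne_zero_of_re_pos hb)] at hΓ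
  rw [Complex.betaIntegral_eq_Gamma_mul_div _ _ hbn hd, hΓ, add_right_comm b d n]
  ring

theorem integral_betaIntegrand_mul_pow (b d : ℂ) (n : ℕ) :
    ∫ t : ℝ in (0 : ℝ)..1, (t : ℂ) ^ (b - 1) * (1 - (t : ℂ)) ^ (d - 1) * (t : ℂ) ^ n =
      Complex.betaIntegral (b + n) d := by
  refine intervalIntegral.integral_congr_ae (ae_of_all _ fun t ht => ?_)
  rw [uIoc_of_le zero_le_one] at ht
  have ht0 : (t : ℂ) ≠ 0 := by exact_mod_cast ht.1.ne'
  rw [add_sub_right_comm, Complex.cpow_add _ _ ht0, Complex.cpow_natCast]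
  ring

variable {a b d : ℂ}

theorem differentiableOn_eulerIntegral (hb : 0 < b.re) (hd : 0 < d.re) :
    DifferentiableOn ℂ (eulerIntegral a b d) {z | 1 - z ∈ Complex.slitPlane} :=
  differentiableOn_integral_mul_one_sub_mul_cpow (Complex.betaIntegral_convergent hb hd) (-a)

theorem eulerIntegral_eq_of_norm_lt_one (hb : 0 < b.re) (hd : 0 < d.re) {z : ℂ} (hz : ‖z‖ < 1) :
    eulerIntegral a b d z = Complex.Gamma b * Complex.Gamma d *
      Complex.regularizedGaussHGFun a b (b + d) z := by
  have hsum := hasSum_integral_mul_one_sub_mul_cpow_neg (Complex.betaIntegral_convergent hb hd) a hz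
  simp_rw [integral_betaIntegrand_mul_pow, betaIntegral_add_nat hb hd] at hsum
  rw [eulerIntegral, ← hsum.tsum_eq, Complex.regularizedGaussHGFun, FormalMultilinearSeries.sum,
    ← tsum_mul_left]
  refine tsum_congr fun n => ?_
  rw [FormalMultilinearSeries.apply_eq_prod_smul_coeff, Finset.prod_const, Finset.card_univ,
    Fintype.card_fin, Complex.coeff_regularizedGaussHGFunSeries, smul_eq_mul]
  field_simp

theorem isRegGaussHG_eulerIntegral (hb : 0 < b.re) (hd : 0 < d.re) :
    IsRegGaussHG a b (b + d)
      fun z => (Complex.Gamma b * Complex.Gamma d)⁻¹ * eulerIntegral a b d z := by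
  refine ⟨(differentiableOn_eulerIntegral hb hd).const_mul _, fun z hz => ?_⟩
  beta_reduce
  rw [eulerIntegral_eq_of_norm_lt_one hb hd hz, inv_mul_cancel_left₀]
  exact mul_ne_zero (Complex.Gamma_ne_zero_of_re_pos hb) (Complex.Gamma_ne_zero_of_re_pos hd)

theorem IsRegGaussHG.symm {a b c : ℂ} {F : ℂ → ℂ} (hF : IsRegGaussHG a b c F) :
    IsRegGaussHG b a c F :=
  ⟨hF.1, fun z hz => by rw [hF.2 z hz, Complex.regularizedGaussHGFun_symm]⟩

theorem regGaussHG_symm (a b c : ℂ) : regGaussHG a b c = regGaussHG b a c := by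
  have h : IsRegGaussHG a b c = IsRegGaussHG b a c :=
    funext fun _ => propext ⟨IsRegGaussHG.symm, IsRegGaussHG.symm⟩
  funext z
  rw [regGaussHG, regGaussHG, h]

end EulerIntegral

section EulerIntegralReal

open Set

/-- Euler's integral `∫₀¹ t^(b-1) (1-t)^(d-1) (1-wt)^(-a) dt` for real parameters and real `w < 1`,
where the integrand is nonnegative. -/
noncomputable def eulerIntegralReal (a b d w : ℝ) : ℝ :=
  ∫ t in (0 : ℝ)..1, t ^ (b - 1) * (1 - t) ^ (d - 1) * (1 - w * t) ^ (-a)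

variable {a b d w t : ℝ}

theorem one_sub_mul_pos (hw : w < 1) (ht : t ∈ Icc (0 : ℝ) 1) : 0 < 1 - w * t := by
  rcases ht.1.eq_or_lt with rfl | ht0
  · simp
  · nlinarith [ht.2]

theorem one_sub_ofReal_mem_slitPlane (hw : w < 1) : 1 - (w : ℂ) ∈ Complex.slitPlane := by
  rw [← Complex.ofReal_one, ← Complex.ofReal_sub, Complex.ofReal_mem_slitPlane]
  exact sub_pos.2 hw

theorem eulerIntegrand_nonneg (hw : w < 1) (ht : t ∈ Icc (0 : ℝ) 1) :
    0 ≤ t ^ (b - 1) * (1 - t) ^ (d - 1) * (1 - w * t) ^ (-a) := by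
  have ht0 := ht.1
  have ht1 := sub_nonneg.2 ht.2
  have hwt := one_sub_mul_pos hw ht
  positivity

theorem ofReal_eulerIntegrand (hw : w < 1) (ht : t ∈ Icc (0 : ℝ) 1) :
    ((t ^ (b - 1) * (1 - t) ^ (d - 1) * (1 - w * t) ^ (-a) : ℝ) : ℂ) =
      (t : ℂ) ^ ((b : ℂ) - 1) * (1 - (t : ℂ)) ^ ((d : ℂ) - 1) *
        (1 - (w : ℂ) * t) ^ (-(a : ℂ)) := by
  push_cast [Complex.ofReal_cpow ht.1, Complex.ofReal_cpow (sub_nonneg.2 ht.2),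
    Complex.ofReal_cpow (one_sub_mul_pos hw ht).le]
  rfl

theorem ofReal_eulerIntegralReal (hw : w < 1) :
    (eulerIntegralReal a b d w : ℂ) = eulerIntegral a b d w := by
  rw [eulerIntegralReal, ← intervalIntegral.integral_ofReal]
  refine intervalIntegral.integral_congr fun t ht => ?_
  rw [uIcc_of_le zero_le_one] at ht
  exact ofReal_eulerIntegrand hw ht

theorem eulerIntegralReal_nonneg (hw : w < 1) : 0 ≤ eulerIntegralReal a b d w :=
  intervalIntegral.integral_nonneg zero_le_one fun _ ht => eulerIntegrand_nonneg hw ht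

theorem intervalIntegrable_eulerIntegrand (hb : 0 < b) (hd : 0 < d) (hw : w < 1) :
    IntervalIntegrable (fun t => t ^ (b - 1) * (1 - t) ^ (d - 1) * (1 - w * t) ^ (-a))
      volume 0 1 := by
  have hβ := Complex.betaIntegral_convergent (u := b) (v := d) (by simpa) (by simpa)
  have h := intervalIntegrable_mul_one_sub_mul_cpow hβ (one_sub_ofReal_mem_slitPlane hw) (-a)
  rw [intervalIntegrable_iff_integrableOn_Ioc_of_le zero_le_one] at h ⊢
  have hcongr := (integrableOn_congr_fun (fun t ht => (ofReal_eulerIntegrand (a := a) hw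
    (Ioc_subset_Icc_self ht)).symm) measurableSet_Ioc).1 h
  simpa only [IntegrableOn, RCLike.re_to_complex, Complex.ofReal_re] using hcongr.re

theorem setLIntegral_eulerIntegrand (hb : 0 < b) (hd : 0 < d) (hw : w < 1) :
    ∫⁻ t in Ioo 0 1, ENNReal.ofReal (t ^ (b - 1) * (1 - t) ^ (d - 1) * (1 - w * t) ^ (-a)) =
      ENNReal.ofReal (eulerIntegralReal a b d w) := by
  have hint := intervalIntegrable_eulerIntegrand (a := a) hb hd hw
  rw [intervalIntegrable_iff_integrableOn_Ioo_of_le zero_le_one] at hint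
  rw [eulerIntegralReal, intervalIntegral.integral_of_le zero_le_one, integral_Ioc_eq_integral_Ioo]
  exact (ofReal_integral_eq_lintegral_ofReal hint <|
    ae_restrict_of_forall_mem measurableSet_Ioo fun t ht =>
      eulerIntegrand_nonneg hw (Ioo_subset_Icc_self ht)).symm

theorem continuousAt_eulerIntegralReal (hb : 0 < b) (hd : 0 < d) (hw : w < 1) :
    ContinuousAt (eulerIntegralReal a b d) w := by
  have hdiff := differentiableOn_eulerIntegral (a := (a : ℂ)) (b := (b : ℂ)) (d := (d : ℂ))
    (by simpa) (by simpa)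
  have hcont : ContinuousAt (eulerIntegral a b d) (w : ℂ) :=
    (hdiff.differentiableAt (isOpen_one_sub_mem_slitPlane.mem_nhds
      (one_sub_ofReal_mem_slitPlane hw))).continuousAt
  refine (Complex.continuous_re.continuousAt.comp
    (hcont.comp Complex.continuous_ofReal.continuousAt)).congr ?_
  filter_upwards [Iio_mem_nhds hw] with v hv
  simp only [Function.comp_apply, ← ofReal_eulerIntegralReal hv, Complex.ofReal_re]

theorem ofReal_eulerIntegralReal_eq_regGaussHG (hb : 0 < b) (hd : 0 < d) (hw : w < 1) :
    (eulerIntegralReal a b d w : ℂ) =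
      ((Real.Gamma b * Real.Gamma d : ℝ) : ℂ) * regGaussHG a b ((b + d : ℝ) : ℂ) w := by
  have hF := isRegGaussHG_eulerIntegral (a := (a : ℂ)) (b := (b : ℂ)) (d := (d : ℂ))
    (by simpa) (by simpa)
  have hΓ : (Real.Gamma b : ℂ) * Real.Gamma d ≠ 0 := by
    exact_mod_cast (mul_pos (Real.Gamma_pos_of_pos hb) (Real.Gamma_pos_of_pos hd)).ne'
  rw [Complex.ofReal_add, hF.regGaussHG_eq (one_sub_ofReal_mem_slitPlane hw),
    ofReal_eulerIntegralReal hw, Complex.Gamma_ofReal, Complex.Gamma_ofReal, Complex.ofReal_mul,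
    mul_inv_cancel_left₀ hΓ]

end EulerIntegralReal

section MulConv

open Set

/-- A nonnegative measurable function vanishing on `(-∞, 0)`, to be used as the density of a measure
on the half-line. No normalization is imposed, and the value at `0` is arbitrary. -/
structure IsHalfLineDensity (f : ℝ → ℝ) : Prop where
  measurable : Measurable f
  nonneg : ∀ x, 0 ≤ f x
  eq_zero_of_neg : ∀ x < 0, f x = 0

/-- `h` is the multiplicative (Mellin) convolution of `f` and `g` on `(0, ∞)`,
`h x = ∫₀^∞ f(u) g(x/u) du/u`. The lower integral makes the convergence of the integral part of the
statement for nonnegative `f`, `g` and `h`. -/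
def IsMulConv (f g h : ℝ → ℝ) : Prop :=
  ∀ x > 0, ∫⁻ u in Ioi 0, ENNReal.ofReal (u⁻¹ * (f u * g (x / u))) = ENNReal.ofReal (h x)

theorem lintegral_comp_mul_left_real {u : ℝ} (hu : u ≠ 0) {F : ℝ → ENNReal} (hF : Measurable F) :
    ∫⁻ v, F (u * v) = ENNReal.ofReal |u⁻¹| * ∫⁻ z, F z := by
  rw [← lintegral_map hF (measurable_const_mul u), Real.map_volume_mul_left hu,
    lintegral_smul_measure, smul_eq_mul]

theorem mconv_withDensity_volume {f g : ℝ → ENNReal} (hf : Measurable f) (hg : Measurable g) :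
    (volume.withDensity f) ∗ₘ (volume.withDensity g) =
      volume.withDensity fun z => ∫⁻ u, ENNReal.ofReal |u⁻¹| * (f u * g (z / u)) := by
  ext A hA
  have hind : Measurable (A.indicator (1 : ℝ → ENNReal)) := measurable_one.indicator hA
  rw [← lintegral_indicator_one hA, Measure.lintegral_mconv hind, withDensity_apply _ hA,
    ← lintegral_indicator hA, lintegral_withDensity_eq_lintegral_mul _ hf (by fun_prop)]
  calc ∫⁻ u, f u * ∫⁻ v, A.indicator 1 (u * v) ∂(volume.withDensity g)
      = ∫⁻ u, ∫⁻ z, ENNReal.ofReal |u⁻¹| * (f u * g (z / u)) * A.indicator 1 z := by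
        refine lintegral_congr_ae ?_
        filter_upwards [volume.ae_ne 0] with u hu
        have hsubst := lintegral_comp_mul_left_real hu
          (F := fun z => g (z / u) * A.indicator 1 z) (by fun_prop)
        simp only [mul_div_cancel_left₀ _ hu] at hsubst
        rw [lintegral_withDensity_eq_lintegral_mul _ hg (by fun_prop)]
        simp only [Pi.mul_apply]
        rw [hsubst, ← lintegral_const_mul _ (by fun_prop), ← lintegral_const_mul _ (by fun_prop)]
        exact lintegral_congr fun z => by ring
    _ = ∫⁻ z, ∫⁻ u, ENNReal.ofReal |u⁻¹| * (f u * g (z / u)) * A.indicator 1 z :=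
        lintegral_lintegral_swap (by fun_prop)
    _ = _ := by
        refine lintegral_congr fun z => ?_
        by_cases hz : z ∈ A <;> simp [hz]

variable {f g h : ℝ → ℝ}

theorem IsHalfLineDensity.ae_nonneg (hf : IsHalfLineDensity f) :
    ∀ᵐ x ∂(volume.withDensity fun x => ENNReal.ofReal (f x)), 0 ≤ x := by
  rw [ae_withDensity_iff hf.measurable.ennreal_ofReal]
  refine ae_of_all _ fun x hx => ?_
  by_contra! hneg
  exact hx (by rw [hf.eq_zero_of_neg x hneg, ENNReal.ofReal_zero])

theorem IsMulConv.lintegral_eq (hconv : IsMulConv f g h) (hf : IsHalfLineDensity f)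
    (hg : IsHalfLineDensity g) (hh : IsHalfLineDensity h) {z : ℝ} (hz : z ≠ 0) :
    ∫⁻ u, ENNReal.ofReal |u⁻¹| * (ENNReal.ofReal (f u) * ENNReal.ofReal (g (z / u))) =
      ENNReal.ofReal (h z) := by
  have hprod (u : ℝ) : ENNReal.ofReal |u⁻¹| * (ENNReal.ofReal (f u) * ENNReal.ofReal (g (z / u))) =
      ENNReal.ofReal (|u⁻¹| * (f u * g (z / u))) := by
    rw [ENNReal.ofReal_mul (abs_nonneg _), ENNReal.ofReal_mul (hf.nonneg u)]
  have hzero {u : ℝ} (hu : ¬ (0 < u ∧ 0 < z / u)) : |u⁻¹| * (f u * g (z / u)) = 0 := by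
    rcases lt_trichotomy u 0 with hneg | rfl | hpos
    · simp [hf.eq_zero_of_neg u hneg]
    · simp
    · have hzu : z / u < 0 := lt_of_le_of_ne (not_lt.1 fun h => hu ⟨hpos, h⟩)
        (div_ne_zero hz hpos.ne')
      simp [hg.eq_zero_of_neg _ hzu]
  simp_rw [hprod]
  rcases lt_or_gt_of_ne hz with hz | hz
  · rw [hh.eq_zero_of_neg z hz, ENNReal.ofReal_zero, lintegral_eq_zero_of_ae_eq_zero]
    exact ae_of_all _ fun u => (congrArg ENNReal.ofReal (hzero fun hu =>
      (div_neg_of_neg_of_pos hz hu.1).not_gt hu.2)).trans ENNReal.ofReal_zero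
  · rw [← hconv z hz, ← lintegral_indicator measurableSet_Ioi]
    refine lintegral_congr fun u => ?_
    by_cases hu : 0 < u
    · rw [indicator_of_mem (mem_Ioi.2 hu), abs_of_pos (inv_pos.2 hu)]
    · rw [indicator_of_notMem (by simpa using hu), hzero fun h => hu h.1, ENNReal.ofReal_zero]

theorem IsMulConv.mconv_withDensity (hconv : IsMulConv f g h) (hf : IsHalfLineDensity f)
    (hg : IsHalfLineDensity g) (hh : IsHalfLineDensity h) :
    (volume.withDensity fun x => ENNReal.ofReal (f x)) ∗ₘ
        (volume.withDensity fun x => ENNReal.ofReal (g x)) =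
      volume.withDensity fun x => ENNReal.ofReal (h x) := by
  rw [mconv_withDensity_volume hf.measurable.ennreal_ofReal hg.measurable.ennreal_ofReal]
  refine withDensity_congr_ae ?_
  filter_upwards [volume.ae_ne 0] with z hz
  exact hconv.lintegral_eq hf hg hh hz

theorem IsMulConv.hasLaw_mul (hconv : IsMulConv f g h) (hf : IsHalfLineDensity f)
    (hg : IsHalfLineDensity g) (hh : IsHalfLineDensity h) {S : Type*} [MeasurableSpace S]
    {P : Measure S} {X Y : S → ℝ}
    (hX : HasLaw X (volume.withDensity fun x => ENNReal.ofReal (f x)) P)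
    (hY : HasLaw Y (volume.withDensity fun x => ENNReal.ofReal (g x)) P) (hXY : IndepFun X Y P) :
    HasLaw (fun ω => X ω * Y ω) (volume.withDensity fun x => ENNReal.ofReal (h x)) P := by
  have hf_sigmaFinite : SigmaFinite (volume.withDensity fun x => ENNReal.ofReal (f x)) :=
    SigmaFinite.withDensity_ofReal _
  have hlaw := hXY.hasLaw_fun_mul hX hY
  rwa [hconv.mconv_withDensity hf hg hh] at hlaw

theorem IsHalfLineDensity.integral_cpow_withDensity (hf : IsHalfLineDensity f) (s : ℂ) :
    ∫ x, (x : ℂ) ^ (s - 1) ∂(volume.withDensity fun x => ENNReal.ofReal (f x)) =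
      mellin (fun t => (f t : ℂ)) s := by
  rw [integral_withDensity_eq_integral_toReal_smul hf.measurable.ennreal_ofReal
    (ae_of_all _ fun _ => ENNReal.ofReal_lt_top), mellin, ← integral_indicator measurableSet_Ioi]
  refine integral_congr_ae ?_
  filter_upwards [volume.ae_ne 0] with u hu
  rw [ENNReal.toReal_ofReal (hf.nonneg u), Complex.real_smul]
  rcases lt_or_gt_of_ne hu with hu | hu
  · rw [indicator_of_notMem (by simpa using hu.le), hf.eq_zero_of_neg u hu, Complex.ofReal_zero,
      zero_mul]
  · rw [indicator_of_mem (mem_Ioi.2 hu), smul_eq_mul, mul_comm]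

theorem IsMulConv.mellin_eq (hconv : IsMulConv f g h) (hf : IsHalfLineDensity f)
    (hg : IsHalfLineDensity g) (hh : IsHalfLineDensity h) (s : ℂ) :
    mellin (fun t => (h t : ℂ)) s =
      mellin (fun t => (f t : ℂ)) s * mellin (fun t => (g t : ℂ)) s := by
  rw [← hf.integral_cpow_withDensity, ← hg.integral_cpow_withDensity,
    ← hh.integral_cpow_withDensity, ← integral_prod_mul, ← hconv.mconv_withDensity hf hg hh,
    Measure.mconv, integral_map (by fun_prop)
      (Measurable.aestronglyMeasurable (by fun_prop))]
  refine integral_congr_ae ?_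
  filter_upwards [Measure.quasiMeasurePreserving_fst.ae hf.ae_nonneg,
    Measure.quasiMeasurePreserving_snd.ae hg.ae_nonneg] with p hp₁ hp₂
  rw [Complex.ofReal_mul, Complex.mul_cpow_ofReal_nonneg hp₁ hp₂]

theorem IsHalfLineDensity.integrable_and_integral_eq (hf : IsHalfLineDensity f) {c : ℝ}
    (hc : c ≠ 0) (hmellin : mellin (fun t => (f t : ℂ)) 2 = c) {S : Type*} [MeasurableSpace S]
    {P : Measure S} {X : S → ℝ}
    (hX : HasLaw X (volume.withDensity fun x => ENNReal.ofReal (f x)) P) :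
    Integrable X P ∧ ∫ ω, X ω ∂P = c := by
  have hmean : ∫ ω, (X ω : ℂ) ∂P = c := by
    have hint := hf.integral_cpow_withDensity 2
    rw [show (2 : ℂ) - 1 = 1 by norm_num, hmellin] at hint
    simp only [Complex.cpow_one] at hint
    rw [← hint]
    exact hX.integral_comp Complex.measurable_ofReal.aestronglyMeasurable
  -- The Bochner integral of a non-integrable function is `0`.
  have hint : Integrable (fun ω => (X ω : ℂ)) P :=
    Integrable.of_integral_ne_zero (by rw [hmean]; exact_mod_cast hc)
  refine ⟨by simpa using hint.re, ?_⟩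
  rw [integral_complex_ofReal] at hmean
  exact_mod_cast hmean

end MulConv

section BetaPrime

open Set

/-- Density of the beta prime distribution with shapes `m`, `α` and rate `κ`, that is, of
`κ⁻¹ * (G / G')` for independent unit gamma variables `G`, `G'` of shapes `m` and `α`. -/
noncomputable def betaPrimePDFReal (m α κ z : ℝ) : ℝ :=
  if 0 < z then Real.Gamma (m + α) / (Real.Gamma m * Real.Gamma α) *
    (κ * (κ * z) ^ (m - 1) * (1 + κ * z) ^ (-(m + α))) else 0

variable {m r α β κ : ℝ}

theorem isHalfLineDensity_gammaPDFReal (hm : 0 < m) (hr : 0 < r) :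
    IsHalfLineDensity (gammaPDFReal m r) where
  measurable := measurable_gammaPDFReal m r
  nonneg := gammaPDFReal_nonneg hm hr
  eq_zero_of_neg _ hx := if_neg hx.not_ge

theorem isHalfLineDensity_invGammaPDFReal (hα : 0 < α) (hβ : 0 ≤ β) :
    IsHalfLineDensity (invGammaPDFReal α β) where
  measurable := Measurable.ite measurableSet_Ioi (by fun_prop) measurable_const
  nonneg y := by
    unfold invGammaPDFReal
    split_ifs <;> positivity
  eq_zero_of_neg _ hy := if_neg hy.le.not_gt

theorem isHalfLineDensity_betaPrimePDFReal (hm : 0 < m) (hα : 0 < α) (hκ : 0 ≤ κ) :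
    IsHalfLineDensity (betaPrimePDFReal m α κ) where
  measurable := Measurable.ite measurableSet_Ioi (by fun_prop) measurable_const
  nonneg z := by
    unfold betaPrimePDFReal
    split_ifs <;> positivity
  eq_zero_of_neg _ hz := if_neg hz.le.not_gt

theorem mellin_gammaPDFReal (hr : 0 < r) {s : ℂ} (hs : -m < s.re) :
    mellin (fun t => (gammaPDFReal m r t : ℂ)) (s + 1) =
      (r : ℂ) ^ (-s) * (Complex.Gamma (m + s) / Complex.Gamma m) := by
  have hr0 : (r : ℂ) ≠ 0 := by exact_mod_cast hr.ne'
  have hms : 0 < (m + s : ℂ).re := by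
    rw [Complex.add_re, Complex.ofReal_re]
    exact neg_lt_iff_pos_add'.1 hs
  calc mellin (fun t => (gammaPDFReal m r t : ℂ)) (s + 1)
      = ∫ t : ℝ in Ioi 0, (r : ℂ) ^ (m : ℂ) / Complex.Gamma m *
          ((t : ℂ) ^ (m + s - 1 : ℂ) * Complex.exp (-(r * t))) := by
        refine setIntegral_congr_fun measurableSet_Ioi fun t (ht : 0 < t) => ?_
        have ht0 : (t : ℂ) ≠ 0 := by exact_mod_cast ht.ne'
        simp only [gammaPDFReal, if_pos ht.le, smul_eq_mul, add_sub_cancel_right]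
        push_cast [Complex.ofReal_cpow hr.le, Complex.ofReal_cpow ht.le, ← Complex.Gamma_ofReal]
        rw [show (m + s - 1 : ℂ) = s + (m - 1) by ring, Complex.cpow_add _ _ ht0]
        ring
    _ = (r : ℂ) ^ (m : ℂ) / Complex.Gamma m * ((r : ℂ) ^ (-(m + s)) * Complex.Gamma (m + s)) := by
        rw [integral_const_mul, Complex.integral_cpow_mul_exp_neg_mul_Ioi hms hr, one_div,
          Complex.inv_cpow_ofReal_nonneg hr.le, Complex.cpow_neg]
    _ = (r : ℂ) ^ (-s) * (Complex.Gamma (m + s) / Complex.Gamma m) := by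
        have hrm : (r : ℂ) ^ (m : ℂ) ≠ 0 := by simp [Complex.cpow_eq_zero_iff, hr0]
        rw [neg_add, Complex.cpow_add _ _ hr0, Complex.cpow_neg]
        field_simp

theorem invGammaPDFReal_eq_gammaPDFReal_inv {y : ℝ} (hy : 0 < y) :
    invGammaPDFReal α β y = y ^ (-2 : ℝ) * gammaPDFReal α β y⁻¹ := by
  rw [invGammaPDFReal, if_pos hy, gammaPDFReal, if_pos (inv_pos.2 hy).le, div_eq_mul_inv β y,
    Real.inv_rpow hy.le, ← Real.rpow_neg hy.le, show α + 1 = -(-2 + -(α - 1)) by ring,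
    Real.rpow_neg hy.le, Real.rpow_add hy]
  field_simp

theorem mellin_invGammaPDFReal (hβ : 0 < β) {s : ℂ} (hs : s.re < α) :
    mellin (fun t => (invGammaPDFReal α β t : ℂ)) (s + 1) =
      (β : ℂ) ^ s * (Complex.Gamma (α - s) / Complex.Gamma α) := by
  have hcongr : mellin (fun t => (invGammaPDFReal α β t : ℂ)) (s + 1) =
      mellin (fun t : ℝ => (t : ℂ) ^ (-2 : ℂ) • (gammaPDFReal α β t⁻¹ : ℂ)) (s + 1) := by
    refine setIntegral_congr_fun measurableSet_Ioi fun t (ht : 0 < t) => ?_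
    simp only [invGammaPDFReal_eq_gammaPDFReal_inv ht, Complex.ofReal_mul,
      Complex.ofReal_cpow ht.le, Complex.ofReal_neg, Complex.ofReal_ofNat, smul_eq_mul]
  rw [hcongr, mellin_cpow_smul, mellin_comp_inv (fun t : ℝ => (gammaPDFReal α β t : ℂ)),
    show -(s + 1 + -2) = -s + 1 by ring, mellin_gammaPDFReal hβ (by simpa using hs), neg_neg,
    ← sub_eq_add_neg]

theorem gammaPDFReal_mul_invGammaPDFReal (hm : 0 < m) (hr : 0 < r) (hα : 0 < α) (hβ : 0 < β)
    {z u : ℝ} (hz : 0 < z) (hu : 0 < u) :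
    u⁻¹ * (gammaPDFReal m r u * invGammaPDFReal α β (z / u)) =
      betaPrimePDFReal m α (r / β) z * gammaPDFReal (m + α) (r + β / z) u := by
  have hrate : 0 < r + β / z := by positivity
  have hκ : 1 + r / β * z = (r + β / z) * (z / β) := by field_simp; ring
  have hexp : Real.exp (-((r + β / z) * u)) =
      Real.exp (-(r * u)) * Real.exp (-(β / z * u)) := by
    rw [← Real.exp_add]
    ring_nf
  have hΓ {a : ℝ} (ha : 0 < a) : Real.Gamma a ≠ 0 := (Real.Gamma_pos_of_pos ha).ne'
  rw [gammaPDFReal, gammaPDFReal, invGammaPDFReal, betaPrimePDFReal, if_pos hu.le, if_pos hu.le,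
    if_pos (by positivity), if_pos hz, hκ, show β / (z / u) = β / z * u by field_simp,
    hexp]
  simp only [Real.rpow_neg, Real.mul_rpow, Real.div_rpow, Real.rpow_add, Real.rpow_sub,
    Real.rpow_one, hrate.le, hr, hr.le, hβ, hβ.le, hz, hz.le, hu, hu.le, div_pos, div_nonneg,
    hrate]
  field_simp [hΓ hm, hΓ hα, hΓ (add_pos hm hα)]

theorem isMulConv_gammaPDFReal_invGammaPDFReal (hm : 0 < m) (hr : 0 < r) (hα : 0 < α)
    (hβ : 0 < β) :
    IsMulConv (gammaPDFReal m r) (invGammaPDFReal α β) (betaPrimePDFReal m α (r / β)) := by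
  intro z hz
  have hκ : 0 ≤ r / β := by positivity
  have hrate : 0 < r + β / z := by positivity
  have hnorm : ∫⁻ u in Ioi 0, gammaPDF (m + α) (r + β / z) u = 1 := by
    rw [← lintegral_gammaPDF_eq_one (add_pos hm hα) hrate]
    refine (setLIntegral_congr Ioi_ae_eq_Ici).trans (setLIntegral_eq_of_support_subset ?_)
    intro u hu
    by_contra hneg
    exact hu (gammaPDF_of_neg (not_le.1 hneg))
  calc ∫⁻ u in Ioi 0, ENNReal.ofReal (u⁻¹ * (gammaPDFReal m r u * invGammaPDFReal α β (z / u)))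
      = ∫⁻ u in Ioi 0, ENNReal.ofReal (betaPrimePDFReal m α (r / β) z) *
          gammaPDF (m + α) (r + β / z) u := by
        refine setLIntegral_congr_fun measurableSet_Ioi fun u hu => ?_
        rw [gammaPDFReal_mul_invGammaPDFReal hm hr hα hβ hz hu, gammaPDF,
          ENNReal.ofReal_mul ((isHalfLineDensity_betaPrimePDFReal hm hα hκ).nonneg z)]
    _ = ENNReal.ofReal (betaPrimePDFReal m α (r / β) z) := by
        rw [lintegral_const_mul (f := gammaPDF (m + α) (r + β / z)) _
          (measurable_gammaPDFReal _ _).ennreal_ofReal, hnorm, mul_one]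

theorem hasLaw_mul_gammaMeasure_invGammaMeasure (hm : 0 < m) (hr : 0 < r) (hα : 0 < α)
    (hβ : 0 < β) {S : Type*} [MeasurableSpace S] {P : Measure S} {X Y : S → ℝ}
    (hX : HasLaw X (gammaMeasure m r) P) (hY : HasLaw Y (invGammaMeasure α β) P)
    (hXY : IndepFun X Y P) :
    HasLaw (fun ω => X ω * Y ω)
      (volume.withDensity fun z => ENNReal.ofReal (betaPrimePDFReal m α (r / β) z)) P :=
  (isMulConv_gammaPDFReal_invGammaPDFReal hm hr hα hβ).hasLaw_mul
    (isHalfLineDensity_gammaPDFReal hm hr) (isHalfLineDensity_invGammaPDFReal hα hβ.le)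
    (isHalfLineDensity_betaPrimePDFReal hm hα (div_pos hr hβ).le) hX hY hXY

theorem mellin_betaPrimePDFReal (hm : 0 < m) (hα : 0 < α) (hκ : 0 < κ) {s : ℂ} (hs : -m < s.re)
    (hs' : s.re < α) :
    mellin (fun t => (betaPrimePDFReal m α κ t : ℂ)) (s + 1) =
      (κ : ℂ) ^ (-s) * (Complex.Gamma (m + s) * Complex.Gamma (α - s) /
        (Complex.Gamma m * Complex.Gamma α)) := by
  have hconv := isMulConv_gammaPDFReal_invGammaPDFReal hm hκ hα one_pos
  rw [div_one] at hconv
  rw [hconv.mellin_eq (isHalfLineDensity_gammaPDFReal hm hκ)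
    (isHalfLineDensity_invGammaPDFReal hα zero_le_one)
    (isHalfLineDensity_betaPrimePDFReal hm hα hκ.le), mellin_gammaPDFReal hκ hs,
    mellin_invGammaPDFReal one_pos hs', Complex.ofReal_one, Complex.one_cpow]
  ring

end BetaPrime

section BetaPrimeMul

open Set

/-- Density of the product of two independent beta prime variables with shapes `m₁, α₁` and
`m₂, α₂`, where `κ` is the product of their rates, in terms of Euler's integral. The argument
`1 - 1 / (κ * x)` runs over `(-∞, 1)` as `x` runs over `(0, ∞)`. -/
noncomputable def betaPrimeMulPDFReal (m₁ α₁ m₂ α₂ κ x : ℝ) : ℝ :=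
  if 0 < x then
    Real.Gamma (m₁ + α₁) / (Real.Gamma m₁ * Real.Gamma α₁) *
      (Real.Gamma (m₂ + α₂) / (Real.Gamma m₂ * Real.Gamma α₂)) * (κ * (κ * x) ^ (-α₂ - 1)) *
      eulerIntegralReal (m₂ + α₂) (m₁ + α₂) (m₂ + α₁) (1 - 1 / (κ * x))
  else 0

theorem one_sub_one_div_lt_one {y : ℝ} (hy : 0 < y) : 1 - 1 / y < 1 :=
  sub_lt_self _ (one_div_pos.2 hy)

variable {m₁ α₁ κ₁ m₂ α₂ κ₂ κ x : ℝ}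

theorem continuousAt_betaPrimeMulPDFReal (hm₁ : 0 < m₁) (hα₁ : 0 < α₁) (hm₂ : 0 < m₂)
    (hα₂ : 0 < α₂) (hκ : 0 < κ) (hx : 0 < x) :
    ContinuousAt (betaPrimeMulPDFReal m₁ α₁ m₂ α₂ κ) x := by
  have hκx : κ * x ≠ 0 := by positivity
  have hEuler : ContinuousAt (fun y => eulerIntegralReal (m₂ + α₂) (m₁ + α₂) (m₂ + α₁)
      (1 - 1 / (κ * y))) x :=
    ContinuousAt.comp (f := fun y => 1 - 1 / (κ * y))
      (continuousAt_eulerIntegralReal (add_pos hm₁ hα₂) (add_pos hm₂ hα₁)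
        (one_sub_one_div_lt_one (by positivity)))
      (continuousAt_const.sub (continuousAt_const.div (by fun_prop) hκx))
  have hpow : ContinuousAt (fun y => κ * (κ * y) ^ (-α₂ - 1)) x :=
    continuousAt_const.mul (ContinuousAt.rpow_const (by fun_prop) (Or.inl hκx))
  have hconst : ContinuousAt (fun _ : ℝ => Real.Gamma (m₁ + α₁) / (Real.Gamma m₁ * Real.Gamma α₁) *
      (Real.Gamma (m₂ + α₂) / (Real.Gamma m₂ * Real.Gamma α₂))) x := continuousAt_const
  refine ((hconst.mul hpow).mul hEuler).congr ?_
  filter_upwards [lt_mem_nhds hx] with y hy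
  exact (if_pos hy).symm

theorem isHalfLineDensity_betaPrimeMulPDFReal (hm₁ : 0 < m₁) (hα₁ : 0 < α₁) (hm₂ : 0 < m₂)
    (hα₂ : 0 < α₂) (hκ : 0 < κ) : IsHalfLineDensity (betaPrimeMulPDFReal m₁ α₁ m₂ α₂ κ) where
  measurable := by
    have hcont : ContinuousOn (betaPrimeMulPDFReal m₁ α₁ m₂ α₂ κ) (Ioi 0) := fun x hx =>
      (continuousAt_betaPrimeMulPDFReal hm₁ hα₁ hm₂ hα₂ hκ hx).continuousWithinAt
    convert hcont.measurable_piecewise (g := fun _ => 0) continuousOn_const measurableSet_Ioi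
      using 1
    ext x
    by_cases hx : 0 < x
    · rw [piecewise_eq_of_mem _ _ _ (mem_Ioi.2 hx)]
    · rw [piecewise_eq_of_notMem _ _ _ (by simpa using hx), betaPrimeMulPDFReal, if_neg hx]
  nonneg x := by
    unfold betaPrimeMulPDFReal
    split_ifs with hx
    · exact mul_nonneg (by positivity)
        (eulerIntegralReal_nonneg (one_sub_one_div_lt_one (by positivity)))
    · exact le_rfl
  eq_zero_of_neg _ hx := if_neg hx.le.not_gt

theorem image_mul_div_one_sub_Ioo (hκ : 0 < κ) :
    (fun t : ℝ => κ⁻¹ * (t / (1 - t))) '' Ioo 0 1 = Ioi 0 := by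
  refine Subset.antisymm ?_ fun u (hu : 0 < u) => ⟨κ * u / (1 + κ * u), ⟨by positivity, ?_⟩, ?_⟩
  · rintro _ ⟨t, ⟨ht₀, ht₁⟩, rfl⟩
    have := sub_pos.2 ht₁
    exact mem_Ioi.2 (by positivity)
  · rw [div_lt_one (by positivity)]
    linarith
  · have hcompl : 1 - κ * u / (1 + κ * u) = 1 / (1 + κ * u) := by field_simp; ring
    simp only [hcompl]
    field_simp

theorem injOn_mul_div_one_sub_Ioo (hκ : κ ≠ 0) :
    InjOn (fun t : ℝ => κ⁻¹ * (t / (1 - t))) (Ioo 0 1) := by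
  intro s hs t ht hst
  have hdiv := mul_left_cancel₀ (inv_ne_zero hκ) hst
  rw [div_eq_div_iff (sub_pos.2 hs.2).ne' (sub_pos.2 ht.2).ne'] at hdiv
  linarith

theorem hasDerivAt_mul_div_one_sub {t : ℝ} (ht : 1 - t ≠ 0) :
    HasDerivAt (fun t : ℝ => κ⁻¹ * (t / (1 - t))) (κ⁻¹ * ((1 - t) ^ 2)⁻¹) t := by
  have hdiv := (hasDerivAt_id' t).fun_div ((hasDerivAt_id' t).const_sub 1) ht
  exact (hdiv.const_mul κ⁻¹).congr_deriv (by ring)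

theorem setLIntegral_Ioi_eq_setLIntegral_Ioo (hκ : 0 < κ) (F : ℝ → ENNReal) :
    ∫⁻ u in Ioi 0, F u = ∫⁻ t in Ioo 0 1,
      ENNReal.ofReal (κ⁻¹ * ((1 - t) ^ 2)⁻¹) * F (κ⁻¹ * (t / (1 - t))) := by
  rw [← image_mul_div_one_sub_Ioo hκ, lintegral_image_eq_lintegral_abs_deriv_mul measurableSet_Ioo
    (fun t ht => (hasDerivAt_mul_div_one_sub (sub_pos.2 ht.2).ne').hasDerivWithinAt)
    (injOn_mul_div_one_sub_Ioo hκ.ne')]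
  refine setLIntegral_congr_fun measurableSet_Ioo fun t ht => ?_
  have := sub_pos.2 ht.2
  simp only [abs_of_pos (show 0 < κ⁻¹ * ((1 - t) ^ 2)⁻¹ by positivity)]

theorem betaPrimePDFReal_mul_div_one_sub {m α t : ℝ} (hκ : 0 < κ) (ht : t ∈ Ioo (0 : ℝ) 1) :
    betaPrimePDFReal m α κ (κ⁻¹ * (t / (1 - t))) =
      Real.Gamma (m + α) / (Real.Gamma m * Real.Gamma α) *
        (κ * t ^ (m - 1) * (1 - t) ^ (α + 1)) := by
  obtain ⟨ht₀, ht₁⟩ := ht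
  have hcompl : 0 < 1 - t := sub_pos.2 ht₁
  have hsum : 1 + t / (1 - t) = (1 - t)⁻¹ := by field_simp; ring
  rw [betaPrimePDFReal, if_pos (by positivity), mul_inv_cancel_left₀ hκ.ne', hsum,
    Real.inv_rpow hcompl.le, Real.rpow_neg hcompl.le, inv_inv, Real.div_rpow ht₀.le hcompl.le,
    show m + α = (m - 1) + (α + 1) by ring, Real.rpow_add hcompl]
  have := Real.rpow_pos_of_pos hcompl (m - 1)
  field_simp

theorem betaPrimePDFReal_mul_betaPrimePDFReal (hκ₁ : 0 < κ₁) (hκ₂ : 0 < κ₂) (hx : 0 < x) {t : ℝ}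
    (ht : t ∈ Ioo (0 : ℝ) 1) :
    κ₁⁻¹ * ((1 - t) ^ 2)⁻¹ * ((κ₁⁻¹ * (t / (1 - t)))⁻¹ *
      (betaPrimePDFReal m₁ α₁ κ₁ (κ₁⁻¹ * (t / (1 - t))) *
        betaPrimePDFReal m₂ α₂ κ₂ (x / (κ₁⁻¹ * (t / (1 - t)))))) =
      Real.Gamma (m₁ + α₁) / (Real.Gamma m₁ * Real.Gamma α₁) *
        (Real.Gamma (m₂ + α₂) / (Real.Gamma m₂ * Real.Gamma α₂)) *
        (κ₁ * κ₂ * (κ₁ * κ₂ * x) ^ (-α₂ - 1)) *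
        (t ^ (m₁ + α₂ - 1) * (1 - t) ^ (m₂ + α₁ - 1) *
          (1 - (1 - 1 / (κ₁ * κ₂ * x)) * t) ^ (-(m₂ + α₂))) := by
  have hq : 0 < 1 - (1 - 1 / (κ₁ * κ₂ * x)) * t :=
    one_sub_mul_pos (one_sub_one_div_lt_one (by positivity)) (Ioo_subset_Icc_self ht)
  obtain ⟨ht₀, ht₁⟩ := ht
  have hs : 0 < 1 - t := sub_pos.2 ht₁
  have hy : 0 < κ₁ * κ₂ * x := by positivity
  have harg : κ₂ * (x / (κ₁⁻¹ * (t / (1 - t)))) = κ₁ * κ₂ * x * (1 - t) / t := by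
    field_simp
  have hone_add : 1 + κ₁ * κ₂ * x * (1 - t) / t =
      (1 - (1 - 1 / (κ₁ * κ₂ * x)) * t) * (κ₁ * κ₂ * x) / t := by
    field_simp
    ring
  rw [betaPrimePDFReal_mul_div_one_sub hκ₁ ⟨ht₀, ht₁⟩, betaPrimePDFReal, if_pos (by positivity),
    harg, hone_add]
  generalize 1 - (1 - 1 / (κ₁ * κ₂ * x)) * t = q at hq ⊢
  generalize κ₁ * κ₂ * x = y at hy ⊢
  generalize 1 - t = s at hs ⊢
  simp only [neg_add, Real.mul_rpow, Real.div_rpow, Real.rpow_add, Real.rpow_sub, Real.rpow_neg,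
    Real.rpow_one, hq, hq.le, hy, hy.le, hs, hs.le, ht₀, ht₀.le, mul_pos, mul_nonneg]
  field_simp

theorem isMulConv_betaPrimePDFReal (hm₁ : 0 < m₁) (hα₁ : 0 < α₁) (hκ₁ : 0 < κ₁) (hm₂ : 0 < m₂)
    (hα₂ : 0 < α₂) (hκ₂ : 0 < κ₂) :
    IsMulConv (betaPrimePDFReal m₁ α₁ κ₁) (betaPrimePDFReal m₂ α₂ κ₂)
      (betaPrimeMulPDFReal m₁ α₁ m₂ α₂ (κ₁ * κ₂)) := by
  intro x hx
  have hw : 1 - 1 / (κ₁ * κ₂ * x) < 1 := one_sub_one_div_lt_one (by positivity)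
  rw [setLIntegral_Ioi_eq_setLIntegral_Ioo hκ₁, betaPrimeMulPDFReal, if_pos hx,
    ENNReal.ofReal_mul (by positivity),
    ← setLIntegral_eulerIntegrand (add_pos hm₁ hα₂) (add_pos hm₂ hα₁) hw,
    ← lintegral_const_mul _ (by fun_prop)]
  refine setLIntegral_congr_fun measurableSet_Ioo fun t ht => ?_
  have := sub_pos.2 ht.2
  rw [← ENNReal.ofReal_mul (by positivity), betaPrimePDFReal_mul_betaPrimePDFReal hκ₁ hκ₂ hx ht,
    ENNReal.ofReal_mul (by positivity)]

theorem mellin_betaPrimeMulPDFReal (hm₁ : 0 < m₁) (hα₁ : 0 < α₁) (hm₂ : 0 < m₂) (hα₂ : 0 < α₂)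
    (hκ : 0 < κ) {s : ℂ} (hm₁s : -m₁ < s.re) (hm₂s : -m₂ < s.re) (hα₁s : s.re < α₁)
    (hα₂s : s.re < α₂) :
    mellin (fun t => (betaPrimeMulPDFReal m₁ α₁ m₂ α₂ κ t : ℂ)) (s + 1) =
      (κ : ℂ) ^ (-s) * (Complex.Gamma (m₁ + s) * Complex.Gamma (m₂ + s) *
        Complex.Gamma (α₁ - s) * Complex.Gamma (α₂ - s) /
        (Complex.Gamma m₁ * Complex.Gamma m₂ * Complex.Gamma α₁ * Complex.Gamma α₂)) := by
  have hconv := isMulConv_betaPrimePDFReal hm₁ hα₁ hκ hm₂ hα₂ one_pos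
  rw [mul_one] at hconv
  rw [hconv.mellin_eq (isHalfLineDensity_betaPrimePDFReal hm₁ hα₁ hκ.le)
    (isHalfLineDensity_betaPrimePDFReal hm₂ hα₂ zero_le_one)
    (isHalfLineDensity_betaPrimeMulPDFReal hm₁ hα₁ hm₂ hα₂ hκ),
    mellin_betaPrimePDFReal hm₁ hα₁ hκ hm₁s hα₁s, mellin_betaPrimePDFReal hm₂ hα₂ one_pos hm₂s hα₂s,
    Complex.ofReal_one, Complex.one_cpow]
  ring

theorem mellin_betaPrimeMulPDFReal_two (hm₁ : 0 < m₁) (hα₁ : 1 < α₁) (hm₂ : 0 < m₂)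
    (hα₂ : 1 < α₂) (hκ : 0 < κ) :
    mellin (fun t => (betaPrimeMulPDFReal m₁ α₁ m₂ α₂ κ t : ℂ)) 2 =
      ((m₁ * m₂ / (κ * ((α₁ - 1) * (α₂ - 1))) : ℝ) : ℂ) := by
  have hne {m : ℝ} (hm : 0 < m) : (m : ℂ) ≠ 0 := by exact_mod_cast hm.ne'
  have hΓne {m : ℝ} (hm : 0 < m) : Complex.Gamma m ≠ 0 := Complex.Gamma_ne_zero_of_re_pos hm
  have hΓ {m : ℝ} (hm : 0 < m) : Complex.Gamma (m + 1) = m * Complex.Gamma m :=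
    Complex.Gamma_add_one _ (hne hm)
  have hα {α : ℝ} (hα : 1 < α) : (α - 1 : ℂ) ≠ 0 ∧ Complex.Gamma (α - 1) ≠ 0 := by
    exact_mod_cast And.intro (hne (sub_pos.2 hα)) (hΓne (sub_pos.2 hα))
  have hΓ' {α : ℝ} (hα' : 1 < α) : Complex.Gamma α = (α - 1) * Complex.Gamma (α - 1) := by
    rw [← Complex.Gamma_add_one _ (hα hα').1, sub_add_cancel]
  have hκ₀ := hne hκ
  have hΓm₁ := hΓne hm₁
  have hΓm₂ := hΓne hm₂
  obtain ⟨hsub₁, hΓsub₁⟩ := hα hα₁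
  obtain ⟨hsub₂, hΓsub₂⟩ := hα hα₂
  rw [← one_add_one_eq_two, mellin_betaPrimeMulPDFReal hm₁ (one_pos.trans hα₁) hm₂
    (one_pos.trans hα₂) hκ (by rw [Complex.one_re]; linarith) (by rw [Complex.one_re]; linarith)
    (by rwa [Complex.one_re]) (by rwa [Complex.one_re]), Complex.cpow_neg_one, hΓ hm₁, hΓ hm₂,
    hΓ' hα₁, hΓ' hα₂]
  push_cast
  field_simp

theorem betaPrimeMulPDFReal_eq_regGaussHG (hm₁ : 0 < m₁) (hα₁ : 0 < α₁) (hm₂ : 0 < m₂)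
    (hα₂ : 0 < α₂) (hκ : 0 < κ) (hx : 0 < x) :
    (betaPrimeMulPDFReal m₁ α₁ m₂ α₂ κ x : ℂ) =
      ((Real.Gamma (m₁ + α₂) * Real.Gamma (m₂ + α₂) * Real.Gamma (m₁ + α₁) *
        Real.Gamma (m₂ + α₁) *
        (1 / (Real.Gamma m₁ * Real.Gamma m₂ * Real.Gamma α₁ * Real.Gamma α₂)) : ℝ) : ℂ) *
      regGaussHG ((m₁ + α₂ : ℝ) : ℂ) ((m₂ + α₂ : ℝ) : ℂ) ((α₁ + α₂ + m₁ + m₂ : ℝ) : ℂ)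
        ((1 - 1 / (κ * x) : ℝ) : ℂ) * ((x ^ (-α₂ - 1) * κ ^ (-α₂) : ℝ) : ℂ) := by
  have hpow : κ * (κ * x) ^ (-α₂ - 1) = x ^ (-α₂ - 1) * κ ^ (-α₂) := by
    rw [Real.mul_rpow hκ.le hx.le, Real.rpow_sub_one hκ.ne']
    field_simp
  rw [betaPrimeMulPDFReal, if_pos hx, Complex.ofReal_mul,
    ofReal_eulerIntegralReal_eq_regGaussHG (add_pos hm₁ hα₂) (add_pos hm₂ hα₁)
      (one_sub_one_div_lt_one (by positivity)), regGaussHG_symm, hpow,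
    show m₁ + α₂ + (m₂ + α₁) = α₁ + α₂ + m₁ + m₂ by ring]
  push_cast
  ring

end BetaPrimeMul

section MeijerG

open Set

theorem norm_complexGamma_le_realGamma_re {z : ℂ} (hz : 0 < z.re) :
    ‖Complex.Gamma z‖ ≤ Real.Gamma z.re := by
  rw [Complex.Gamma_eq_integral hz, Real.Gamma_eq_integral hz, Complex.GammaIntegral]
  refine (norm_integral_le_integral_norm _).trans_eq ?_
  refine setIntegral_congr_fun measurableSet_Ioi fun x (hx : 0 < x) => ?_
  simp only [norm_mul, Complex.norm_cpow_eq_rpow_re_of_pos hx, Complex.sub_re, Complex.one_re]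
  rw [Complex.norm_of_nonneg (Real.exp_pos _).le]

theorem continuous_complexGamma_comp {X : Type*} [TopologicalSpace X] {u : X → ℂ}
    (hu : Continuous u) (hpos : ∀ x, 0 < (u x).re) : Continuous fun x => Complex.Gamma (u x) := by
  refine continuous_iff_continuousAt.2 fun x => ContinuousAt.comp (f := u)
    (Complex.differentiableAt_Gamma _ fun n hn => ?_).continuousAt hu.continuousAt
  have hre := hpos x
  rw [hn, Complex.neg_re, Complex.natCast_re] at hre
  exact (neg_nonpos.2 n.cast_nonneg).not_gt hre

theorem norm_complexGamma_le_inv_one_add_im_sq {z : ℂ} (hz : 0 < z.re) :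
    ‖Complex.Gamma z‖ ≤ Real.Gamma (z.re + 2) / min (z.re ^ 2) 1 * (1 + z.im ^ 2)⁻¹ := by
  have hz₀ : z ≠ 0 := fun h => hz.ne' (congrArg Complex.re h)
  have hre₁ : 0 < (z + 1).re := by
    rw [Complex.add_re, Complex.one_re]
    positivity
  have hz₁ : z + 1 ≠ 0 := fun h => hre₁.ne' (congrArg Complex.re h)
  have hc : 0 < min (z.re ^ 2) 1 := lt_min (by positivity) one_pos
  have hΓ : ‖z‖ * ‖z + 1‖ * ‖Complex.Gamma z‖ ≤ Real.Gamma (z.re + 2) := by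
    have hbound := norm_complexGamma_le_realGamma_re (z := z + 1 + 1)
      (by rw [Complex.add_re, Complex.one_re]; positivity)
    rw [Complex.Gamma_add_one _ hz₁, Complex.Gamma_add_one _ hz₀, norm_mul, norm_mul] at hbound
    rw [show z.re + 2 = (z + 1 + 1).re by simp only [Complex.add_re, Complex.one_re]; ring]
    linarith
  have hnorm : ‖z‖ ≤ ‖z + 1‖ := by
    rw [← sq_le_sq₀ (norm_nonneg _) (norm_nonneg _), Complex.sq_norm, Complex.sq_norm,
      Complex.normSq_apply, Complex.normSq_apply, Complex.add_re, Complex.add_im, Complex.one_re,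
      Complex.one_im, add_zero]
    nlinarith
  have hquad : min (z.re ^ 2) 1 * (1 + z.im ^ 2) ≤ ‖z‖ * ‖z + 1‖ := by
    calc min (z.re ^ 2) 1 * (1 + z.im ^ 2)
        = min (z.re ^ 2) 1 + min (z.re ^ 2) 1 * z.im ^ 2 := by ring
      _ ≤ z.re ^ 2 + 1 * z.im ^ 2 := by gcongr <;> simp
      _ = ‖z‖ * ‖z‖ := by rw [← sq ‖z‖, Complex.sq_norm, Complex.normSq_apply]; ring
      _ ≤ ‖z‖ * ‖z + 1‖ := by gcongr
  rw [← div_eq_mul_inv, div_div, le_div_iff₀ (mul_pos hc (by positivity)), mul_comm]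
  exact (mul_le_mul_of_nonneg_right hquad (norm_nonneg _)).trans hΓ

theorem integrable_complexGamma_add_mul_I {w : ℂ} (hw : 0 < w.re) :
    Integrable fun t : ℝ => Complex.Gamma (w + t * Complex.I) := by
  have hreal : Integrable fun t : ℝ => Complex.Gamma (w.re + t * Complex.I) :=
    (integrable_inv_one_add_sq.const_mul (Real.Gamma (w.re + 2) / min (w.re ^ 2) 1)).mono'
      (continuous_complexGamma_comp (by fun_prop) (by simpa using hw)).aestronglyMeasurable
      (ae_of_all _ fun t => by
        simpa using norm_complexGamma_le_inv_one_add_im_sq (z := w.re + t * Complex.I)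
          (by simpa using hw))
  refine (hreal.comp_add_right w.im).congr (ae_of_all _ fun t => ?_)
  conv_rhs => rw [← Complex.re_add_im w]
  simp only [Complex.ofReal_add]
  ring_nf

variable {m n p q : ℕ}

theorem meijerKernel_self (a : Fin p → ℂ) (b : Fin q → ℂ) (s : ℂ) :
    meijerKernel q p a b s =
      (∏ j, Complex.Gamma (b j - s)) * ∏ k, Complex.Gamma (1 - a k + s) := by
  simp only [meijerKernel, Fin.is_lt, if_true]

theorem MeijerSeparates.re_sub_pos {a : Fin p → ℂ} {b : Fin q → ℂ} {s : ℂ}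
    (hsep : MeijerSeparates m n a b s.re) {j : Fin q} (hj : j < m) : 0 < (b j - s).re := by
  rw [Complex.sub_re]
  exact sub_pos.2 (hsep.1 j hj)

theorem MeijerSeparates.re_one_sub_add_pos {a : Fin p → ℂ} {b : Fin q → ℂ} {s : ℂ}
    (hsep : MeijerSeparates m n a b s.re) {k : Fin p} (hk : k < n) : 0 < (1 - a k + s).re := by
  rw [Complex.add_re, Complex.sub_re, Complex.one_re]
  linarith [hsep.2 k hk]

theorem meijerKernel_self_ne_zero {a : Fin p → ℂ} {b : Fin q → ℂ} {s : ℂ}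
    (hsep : MeijerSeparates q p a b s.re) : meijerKernel q p a b s ≠ 0 := by
  rw [meijerKernel_self]
  exact mul_ne_zero
    (Finset.prod_ne_zero_iff.2 fun j _ =>
      Complex.Gamma_ne_zero_of_re_pos (hsep.re_sub_pos j.is_lt))
    (Finset.prod_ne_zero_iff.2 fun k _ =>
      Complex.Gamma_ne_zero_of_re_pos (hsep.re_one_sub_add_pos k.is_lt))

theorem verticalIntegrable_meijerKernel {a : Fin p → ℂ} {b : Fin (q + 1) → ℂ} {σ : ℝ}
    (hsep : MeijerSeparates (q + 1) p a b σ) :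
    Complex.VerticalIntegrable (meijerKernel (q + 1) p a b) σ := by
  have hb (j) : 0 < (b j - σ).re := MeijerSeparates.re_sub_pos hsep j.is_lt
  have ha (k) : 0 < (1 - a k + σ).re := MeijerSeparates.re_one_sub_add_pos hsep k.is_lt
  have hb_re (j) (t : ℝ) : (b j - (σ + t * Complex.I)).re = (b j - σ).re := by simp
  have ha_re (k) (t : ℝ) : (1 - a k + (σ + t * Complex.I)).re = (1 - a k + σ).re := by simp
  have hfirst : Integrable fun t : ℝ => Complex.Gamma (b 0 - (σ + t * Complex.I)) := by
    refine (integrable_complexGamma_add_mul_I (hb 0)).comp_neg.congr (ae_of_all _ fun t => ?_)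
    simp only [Complex.ofReal_neg]
    ring_nf
  have hbound (t : ℝ) : ‖(∏ j : Fin q, Complex.Gamma (b j.succ - (σ + t * Complex.I))) *
      ∏ k, Complex.Gamma (1 - a k + (σ + t * Complex.I))‖ ≤
      (∏ j : Fin q, Real.Gamma (b j.succ - σ).re) * ∏ k, Real.Gamma (1 - a k + σ).re := by
    rw [norm_mul, norm_prod, norm_prod]
    gcongr with j _ k _
    · exact Finset.prod_nonneg fun j _ => (Real.Gamma_pos_of_pos (hb j.succ)).le
    · rw [← hb_re j.succ t]
      exact norm_complexGamma_le_realGamma_re (by rw [hb_re]; exact hb _)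
    · rw [← ha_re k t]
      exact norm_complexGamma_le_realGamma_re (by rw [ha_re]; exact ha _)
  have hcont : Continuous fun t : ℝ =>
      (∏ j : Fin q, Complex.Gamma (b j.succ - (σ + t * Complex.I))) *
        ∏ k, Complex.Gamma (1 - a k + (σ + t * Complex.I)) :=
    (continuous_finsetProd _ fun j _ => continuous_complexGamma_comp (by fun_prop)
      fun t => by rw [hb_re]; exact hb _).mul
    (continuous_finsetProd _ fun k _ => continuous_complexGamma_comp (by fun_prop)
      fun t => by rw [ha_re]; exact ha _)
  refine (hfirst.mul_bdd hcont.aestronglyMeasurable (ae_of_all _ hbound)).congr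
    (ae_of_all _ fun t => ?_)
  simp only [meijerKernel_self, Fin.prod_univ_succ, mul_assoc]

theorem eq_meijerG_of_mellin {a : Fin p → ℂ} {b : Fin q → ℂ} {f : ℝ → ℂ} {κ x : ℝ} {C : ℂ}
    (hκ : 0 < κ) (hx : 0 < x) (hfx : ContinuousAt f x) (hsep : ∃ σ, MeijerSeparates m n a b σ)
    (hconv : ∀ σ : ℝ, MeijerSeparates m n a b σ → MellinConvergent f (-σ))
    (hvert : ∀ σ, MeijerSeparates m n a b σ →
      Complex.VerticalIntegrable (meijerKernel m n a b) σ)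
    (hmellin : ∀ s : ℂ, MeijerSeparates m n a b s.re →
      mellin f (-s) = C * ((κ : ℂ) ^ s * meijerKernel m n a b s)) :
    f x = C * meijerG m n a b ((κ * x : ℝ) : ℂ) := by
  rw [meijerG, dif_pos hsep]
  have hσ := hsep.choose_spec
  set σ := hsep.choose
  set K : ℂ → ℂ := meijerKernel m n a b
  have hline (y : ℝ) : ((-σ : ℝ) : ℂ) + ((-y : ℝ) : ℂ) * Complex.I = -(σ + y * Complex.I) := by
    push_cast
    ring
  have hre (y : ℝ) : ((σ : ℂ) + y * Complex.I).re = σ := by simp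
  have hline_mellin (y : ℝ) : mellin f (-(σ + y * Complex.I)) =
      C * ((κ : ℂ) ^ (σ + y * Complex.I : ℂ) * K (σ + y * Complex.I)) :=
    hmellin _ (by rwa [hre])
  have hvert_mellin : Complex.VerticalIntegrable (mellin f) (-σ) := by
    have hpow : Continuous fun y : ℝ => (κ : ℂ) ^ (σ + y * Complex.I : ℂ) :=
      Continuous.const_cpow (by fun_prop) (Or.inl (by exact_mod_cast hκ.ne'))
    have hint := ((hvert σ hσ).bdd_mul hpow.aestronglyMeasurable (ae_of_all _ fun y =>
      (Complex.norm_cpow_eq_rpow_re_of_pos hκ _).trans_le (by rw [hre]))).const_mul C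
    refine hint.comp_neg.congr (ae_of_all _ fun y => ?_)
    simp only [← hline_mellin, ← hline, neg_neg]
  rw [← mellinInv_mellin_eq (-σ) f hx (by simpa using hconv σ hσ) hvert_mellin hfx, mellinInv,
    ← integral_neg_eq_self]
  have hintegrand (y : ℝ) : (x : ℂ) ^ (-(((-σ : ℝ) : ℂ) + ((-y : ℝ) : ℂ) * Complex.I)) •
      mellin f (((-σ : ℝ) : ℂ) + ((-y : ℝ) : ℂ) * Complex.I) =
      C * (K (σ + y * Complex.I) * ((κ * x : ℝ) : ℂ) ^ (σ + y * Complex.I : ℂ)) := by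
    rw [hline, neg_neg, hline_mellin, Complex.ofReal_mul,
      Complex.mul_cpow_ofReal_nonneg hκ.le hx.le, smul_eq_mul]
    ring
  simp_rw [hintegrand, integral_const_mul, Complex.real_smul]
  push_cast
  ring

theorem meijerSeparates_two_two_iff {a₁ a₂ b₁ b₂ : ℂ} {σ : ℝ} :
    MeijerSeparates 2 2 ![1 - a₁, 1 - a₂] ![b₁, b₂] σ ↔
      (σ < b₁.re ∧ σ < b₂.re) ∧ -a₁.re < σ ∧ -a₂.re < σ := by
  simp [MeijerSeparates, Fin.forall_fin_two]

variable {m₁ α₁ m₂ α₂ κ x : ℝ}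

theorem mellin_betaPrimeMulPDFReal_eq_meijerKernel (hm₁ : 0 < m₁) (hα₁ : 0 < α₁) (hm₂ : 0 < m₂)
    (hα₂ : 0 < α₂) (hκ : 0 < κ) {s : ℂ}
    (hsep : MeijerSeparates 2 2 ![1 - (α₂ : ℂ), 1 - (α₁ : ℂ)] ![(m₁ : ℂ), (m₂ : ℂ)] s.re) :
    mellin (fun t => (betaPrimeMulPDFReal m₁ α₁ m₂ α₂ κ t : ℂ)) (-s + 1) =
      1 / (Complex.Gamma m₁ * Complex.Gamma m₂ * Complex.Gamma α₁ * Complex.Gamma α₂) *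
        ((κ : ℂ) ^ s *
          meijerKernel 2 2 ![1 - (α₂ : ℂ), 1 - (α₁ : ℂ)] ![(m₁ : ℂ), (m₂ : ℂ)] s) := by
  obtain ⟨⟨hsm₁, hsm₂⟩, hsα₂, hsα₁⟩ := meijerSeparates_two_two_iff.1 hsep
  rw [mellin_betaPrimeMulPDFReal hm₁ hα₁ hm₂ hα₂ hκ (by simpa using hsm₁) (by simpa using hsm₂)
    (by simpa [neg_lt] using hsα₁) (by simpa [neg_lt] using hsα₂), meijerKernel_self]
  simp only [Fin.prod_univ_two, Matrix.cons_val_zero, Matrix.cons_val_one, neg_neg,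
    sub_sub_cancel, ← sub_eq_add_neg, sub_neg_eq_add]
  ring

theorem betaPrimeMulPDFReal_eq_meijerG (hm₁ : 0 < m₁) (hα₁ : 0 < α₁) (hm₂ : 0 < m₂)
    (hα₂ : 0 < α₂) (hκ : 0 < κ) (hx : 0 < x) :
    (betaPrimeMulPDFReal m₁ α₁ m₂ α₂ κ x : ℂ) =
      ((x⁻¹ * (1 / (Real.Gamma m₁ * Real.Gamma m₂ * Real.Gamma α₁ * Real.Gamma α₂)) : ℝ) : ℂ) *
      meijerG 2 2 ![1 - (α₂ : ℂ), 1 - (α₁ : ℂ)] ![(m₁ : ℂ), (m₂ : ℂ)] ((κ * x : ℝ) : ℂ) := by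
  set a : Fin 2 → ℂ := ![1 - (α₂ : ℂ), 1 - (α₁ : ℂ)]
  set b : Fin 2 → ℂ := ![(m₁ : ℂ), (m₂ : ℂ)]
  set C : ℂ :=
    1 / (Complex.Gamma m₁ * Complex.Gamma m₂ * Complex.Gamma α₁ * Complex.Gamma α₂) with hC_def
  set f : ℝ → ℂ := fun t => (t : ℂ) ^ (1 : ℂ) • (betaPrimeMulPDFReal m₁ α₁ m₂ α₂ κ t : ℂ) with hf
  have hΓ {r : ℝ} (hr : 0 < r) : Complex.Gamma r ≠ 0 := Complex.Gamma_ne_zero_of_re_pos hr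
  have hC : C ≠ 0 := one_div_ne_zero
    (mul_ne_zero (mul_ne_zero (mul_ne_zero (hΓ hm₁) (hΓ hm₂)) (hΓ hα₁)) (hΓ hα₂))
  have hmellin (s : ℂ) (hs : MeijerSeparates 2 2 a b s.re) :
      mellin f (-s) = C * ((κ : ℂ) ^ s * meijerKernel 2 2 a b s) := by
    rw [mellin_cpow_smul, mellin_betaPrimeMulPDFReal_eq_meijerKernel hm₁ hα₁ hm₂ hα₂ hκ hs]
  have hconv (σ : ℝ) (hσ : MeijerSeparates 2 2 a b (σ : ℂ).re) : MellinConvergent f (-σ) :=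
    Integrable.of_integral_ne_zero ((hmellin σ hσ).trans_ne (mul_ne_zero hC (mul_ne_zero
      (by simp [Complex.cpow_eq_zero_iff, hκ.ne']) (meijerKernel_self_ne_zero hσ))))
  have hcont : ContinuousAt f x := by
    simp only [hf, Complex.cpow_one]
    exact Complex.continuous_ofReal.continuousAt.smul
      (Complex.continuous_ofReal.continuousAt.comp
        (continuousAt_betaPrimeMulPDFReal hm₁ hα₁ hm₂ hα₂ hκ hx))
  have hsep : MeijerSeparates 2 2 a b 0 := meijerSeparates_two_two_iff.2 (by simp [*])
  have hG := eq_meijerG_of_mellin hκ hx hcont ⟨0, hsep⟩ hconv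
    (fun σ hσ => verticalIntegrable_meijerKernel hσ) hmellin
  simp only [hf, Complex.cpow_one, smul_eq_mul] at hG
  rw [← eq_inv_mul_iff_mul_eq₀ (by exact_mod_cast hx.ne')] at hG
  rw [hG, hC_def]
  push_cast [Complex.Gamma_ofReal]
  ring

end MeijerG

theorem mainTheorem2_general {S : Type*} [MeasurableSpace S] {P : Measure S}
    {m₁ m₂ α₁ α₂ γ₁ γ₂ Ω₁ Ω₂ : ℝ}
    (hm₁ : 0 < m₁) (hm₂ : 0 < m₂) (hα₁ : 0 < α₁) (hα₂ : 0 < α₂)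
    (hγ₁ : 0 < γ₁) (hγ₂ : 0 < γ₂) (hΩ₁ : 0 < Ω₁) (hΩ₂ : 0 < Ω₂)
    {X₁ X₂ I₁ I₂ : S → ℝ}
    (hX₁ : HasLaw X₁ (gammaMeasure m₁ (m₁ / Ω₁)) P) (hX₂ : HasLaw X₂ (gammaMeasure m₂ (m₂ / Ω₂)) P)
    (hI₁ : HasLaw I₁ (invGammaMeasure α₁ γ₁) P) (hI₂ : HasLaw I₂ (invGammaMeasure α₂ γ₂) P)
    (hXI₁ : IndepFun X₁ I₁ P) (hXI₂ : IndepFun X₂ I₂ P)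
    (hM : IndepFun (fun ω => X₁ ω * I₁ ω) (fun ω => X₂ ω * I₂ ω) P)
    {γbar γtil S₁ : ℝ} (hγbar : γbar = Ω₁ * Ω₂ * (γ₁ * γ₂)) (hγtil : γtil = m₁ * m₂ / γbar)
    (hS₁ : S₁ = 1 / (Real.Gamma m₁ * Real.Gamma m₂ * Real.Gamma α₁ * Real.Gamma α₂)) :
    (∃ f : ℝ → ℝ, Measurable f ∧ (∀ x, 0 ≤ f x) ∧ (∀ x ≤ 0, f x = 0) ∧
      HasLaw (fun ω => X₁ ω * I₁ ω * (X₂ ω * I₂ ω))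
        (volume.withDensity fun x => ENNReal.ofReal (f x)) P ∧
      ∀ x : ℝ, 0 < x →
        (f x : ℂ) = ((x⁻¹ * S₁ : ℝ) : ℂ) *
          meijerG 2 2 ![1 - (α₂ : ℂ), 1 - (α₁ : ℂ)] ![(m₁ : ℂ), (m₂ : ℂ)]
            ((m₁ * m₂ * x / γbar : ℝ) : ℂ) ∧
        (f x : ℂ) =
          ((Real.Gamma (m₁ + α₂) * Real.Gamma (m₂ + α₂) * Real.Gamma (m₁ + α₁) *
            Real.Gamma (m₂ + α₁) * S₁ : ℝ) : ℂ) *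
          regGaussHG ((m₁ + α₂ : ℝ) : ℂ) ((m₂ + α₂ : ℝ) : ℂ) ((α₁ + α₂ + m₁ + m₂ : ℝ) : ℂ)
            ((1 - 1 / (γtil * x) : ℝ) : ℂ) *
          ((x ^ (-α₂ - 1) * γtil ^ (-α₂) : ℝ) : ℂ)) ∧
    (1 < α₁ → 1 < α₂ → Integrable (fun ω => X₁ ω * I₁ ω * (X₂ ω * I₂ ω)) P ∧
      ∫ ω, X₁ ω * I₁ ω * (X₂ ω * I₂ ω) ∂P = γbar / ((α₁ - 1) * (α₂ - 1))) := by
  have hr₁ : 0 < m₁ / Ω₁ := div_pos hm₁ hΩ₁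
  have hr₂ : 0 < m₂ / Ω₂ := div_pos hm₂ hΩ₂
  have hκ₁ : 0 < m₁ / Ω₁ / γ₁ := div_pos hr₁ hγ₁
  have hκ₂ : 0 < m₂ / Ω₂ / γ₂ := div_pos hr₂ hγ₂
  have hγbar₀ : 0 < γbar := hγbar ▸ by positivity
  have hγtil₀ : 0 < γtil := hγtil ▸ by positivity
  have hκ : m₁ / Ω₁ / γ₁ * (m₂ / Ω₂ / γ₂) = γtil := by
    rw [hγtil, hγbar]
    field_simp
  have hdens := isHalfLineDensity_betaPrimeMulPDFReal hm₁ hα₁ hm₂ hα₂ hγtil₀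
  have hγlaw := (hκ ▸ isMulConv_betaPrimePDFReal hm₁ hα₁ hκ₁ hm₂ hα₂ hκ₂).hasLaw_mul
    (isHalfLineDensity_betaPrimePDFReal hm₁ hα₁ hκ₁.le)
    (isHalfLineDensity_betaPrimePDFReal hm₂ hα₂ hκ₂.le) hdens
    (hasLaw_mul_gammaMeasure_invGammaMeasure hm₁ hr₁ hα₁ hγ₁ hX₁ hI₁ hXI₁)
    (hasLaw_mul_gammaMeasure_invGammaMeasure hm₂ hr₂ hα₂ hγ₂ hX₂ hI₂ hXI₂) hM
  refine ⟨⟨betaPrimeMulPDFReal m₁ α₁ m₂ α₂ γtil, hdens.measurable, hdens.nonneg,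
    fun x hx => if_neg hx.not_gt, hγlaw, fun x hx => ⟨?_, ?_⟩⟩, fun hα₁' hα₂' => ?_⟩
  · rw [hS₁, betaPrimeMulPDFReal_eq_meijerG hm₁ hα₁ hm₂ hα₂ hγtil₀ hx, hγtil, div_mul_eq_mul_div]
  · rw [hS₁, betaPrimeMulPDFReal_eq_regGaussHG hm₁ hα₁ hm₂ hα₂ hγtil₀ hx]
  · have hsub₁ := sub_pos.2 hα₁'
    have hsub₂ := sub_pos.2 hα₂'
    refine hdens.integrable_and_integral_eq (by positivity) ?_ hγlaw
    rw [mellin_betaPrimeMulPDFReal_two hm₁ hα₁' hm₂ hα₂' hγtil₀, hγtil]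
    congr 1
    field_simp

theorem mainTheorem2 {S : Type*} [MeasurableSpace S] (P : Measure S) [IsProbabilityMeasure P]
    (m₁ m₂ α₁ α₂ γ₁ γ₂ Ω : ℝ)
    (hm₁ : 0 < m₁) (hm₂ : 0 < m₂) (hα₁ : 1 < α₁) (hα₂ : 1 < α₂)
    (hγ₁ : 0 < γ₁) (hγ₂ : 0 < γ₂) (hΩ : 0 < Ω)
    (N₁ N₂ I₁ I₂ : S → ℝ)
    (hN₁ : HasLaw (fun ω => N₁ ω ^ 2) (gammaMeasure m₁ (m₁ / Ω)) P)
    (hN₂ : HasLaw (fun ω => N₂ ω ^ 2) (gammaMeasure m₂ (m₂ / Ω)) P)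
    (hI₁ : HasLaw I₁ (invGammaMeasure α₁ γ₁) P)
    (hI₂ : HasLaw I₂ (invGammaMeasure α₂ γ₂) P)
    (hNI₁ : IndepFun N₁ I₁ P) (hNI₂ : IndepFun N₂ I₂ P)
    (hM : IndepFun (fun ω => N₁ ω ^ 2 * I₁ ω) (fun ω => N₂ ω ^ 2 * I₂ ω) P)
    (γbar γtil S₁ : ℝ)
    (hγbar : γbar = Ω ^ 2 * (γ₁ * γ₂))
    (hγtil : γtil = m₁ * m₂ / γbar)
    (hS₁ : S₁ = 1 / (Real.Gamma m₁ * Real.Gamma m₂ * Real.Gamma α₁ * Real.Gamma α₂)) :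
    (∃ f : ℝ → ℝ, Measurable f ∧ (∀ x, 0 ≤ f x) ∧ (∀ x ≤ 0, f x = 0) ∧
      HasLaw (fun ω => N₁ ω ^ 2 * I₁ ω * (N₂ ω ^ 2 * I₂ ω))
        (volume.withDensity fun x => ENNReal.ofReal (f x)) P ∧
      ∀ x : ℝ, 0 < x →
        (f x : ℂ) = ((x⁻¹ * S₁ : ℝ) : ℂ) *
          meijerG 2 2 ![1 - (α₂ : ℂ), 1 - (α₁ : ℂ)] ![(m₁ : ℂ), (m₂ : ℂ)]
            ((m₁ * m₂ * x / γbar : ℝ) : ℂ) ∧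
        (f x : ℂ) =
          ((Real.Gamma (m₁ + α₂) * Real.Gamma (m₂ + α₂) * Real.Gamma (m₁ + α₁) *
            Real.Gamma (m₂ + α₁) * S₁ : ℝ) : ℂ) *
          regGaussHG ((m₁ + α₂ : ℝ) : ℂ) ((m₂ + α₂ : ℝ) : ℂ) ((α₁ + α₂ + m₁ + m₂ : ℝ) : ℂ)
            ((1 - 1 / (γtil * x) : ℝ) : ℂ) *
          ((x ^ (-α₂ - 1) * γtil ^ (-α₂) : ℝ) : ℂ)) ∧
    Integrable (fun ω => N₁ ω ^ 2 * I₁ ω * (N₂ ω ^ 2 * I₂ ω)) P ∧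
    ∫ ω, N₁ ω ^ 2 * I₁ ω * (N₂ ω ^ 2 * I₂ ω) ∂P = γbar / ((α₁ - 1) * (α₂ - 1)) := by
  have hgeneral := mainTheorem2_general hm₁ hm₂ (one_pos.trans hα₁) (one_pos.trans hα₂) hγ₁ hγ₂
    hΩ hΩ hN₁ hN₂ hI₁ hI₂ (hNI₁.comp (measurable_id.pow_const 2) measurable_id)
    (hNI₂.comp (measurable_id.pow_const 2) measurable_id) hM (hγbar.trans (by rw [sq])) hγtil hS₁
  exact ⟨hgeneral.1, hgeneral.2 hα₁ hα₂⟩
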